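/- Let $\mathscr{A}$ be a von Neumann algebra of bounded operators on a complex Hilbert space $H$, and let $\mathscr{A}\otimes\mathscr{A}$ be its spatial tensor product with itself, i.e. the von Neumann algebra on the Hilbert space tensor product $H\otimes H$ generated by the operators $a\otimes b$ with $a,b\in\mathscr{A}$. Let $\delta\colon\mathscr{A}\otimes\mathscr{A}\to\mathscr{A}$ be a duplicator on $\mathscr{A}$: a normal positive linear map with $\delta(1)\le 1$ for which there is an element $u\in\mathscr{A}$ with $0\le u\le 1$ (a unit) such that \[ \delta(a\otimes u)=a=\delta(u\otimes a)\qquad\text{for all } a\in\mathscr{A}. \] Here normal means that $\delta$ preserves suprema of bounded directed sets of self-adjoint elements. Then $\mathscr{A}$ is abelian, and $\delta(a\otimes b)=a\cdot b$ for all $a,b\in\mathscr{A}$. -/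

import Mathlib

open scoped TensorProduct

noncomputable section

namespace VonNeumannAlgebra

variable {H : Type*} [NormedAddCommGroup H] [InnerProductSpace ℂ H] [CompleteSpace H]
variable {K : Type*} [NormedAddCommGroup K] [InnerProductSpace ℂ K] [CompleteSpace K]

/-- The underlying type of a von Neumann algebra `A` of bounded operators on `H`, with the
operations and the (Loewner) order inherited from `H →L[ℂ] H`. -/
abbrev Elem (A : VonNeumannAlgebra H) : Type _ := A.toStarSubalgebra

/-- The von Neumann algebra generated by a set `S` of bounded operators: the double commutant
of the star-closure of `S`. -/
def generated (S : Set (H →L[ℂ] H)) : VonNeumannAlgebra H where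
  toStarSubalgebra := StarSubalgebra.centralizer ℂ (StarSubalgebra.centralizer ℂ S)
  centralizer_centralizer' := by
    change Set.centralizer (Set.centralizer
      ((StarSubalgebra.centralizer ℂ (StarSubalgebra.centralizer ℂ S : Set (H →L[ℂ] H)) :
        StarSubalgebra ℂ (H →L[ℂ] H)) : Set (H →L[ℂ] H))) =
      ((StarSubalgebra.centralizer ℂ (StarSubalgebra.centralizer ℂ S : Set (H →L[ℂ] H)) :
        StarSubalgebra ℂ (H →L[ℂ] H)) : Set (H →L[ℂ] H))
    rw [StarSubalgebra.coe_centralizer_centralizer, Set.centralizer_centralizer_centralizer]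

theorem subset_generated (S : Set (H →L[ℂ] H)) {x : H →L[ℂ] H} (hx : x ∈ S) :
    x ∈ (generated S).toStarSubalgebra := by
  change x ∈ ((StarSubalgebra.centralizer ℂ (StarSubalgebra.centralizer ℂ S :
    Set (H →L[ℂ] H)) : StarSubalgebra ℂ (H →L[ℂ] H)) : Set (H →L[ℂ] H))
  rw [StarSubalgebra.coe_centralizer_centralizer]
  exact Set.subset_centralizer_centralizer (Or.inl hx)

/-- The Hilbert space tensor product: the completion of the algebraic tensor product for the
inner product with `⟪x ⊗ y, x' ⊗ y'⟫ = ⟪x, x'⟫ * ⟪y, y'⟫`. -/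
abbrev HilbertTensor (H : Type*) [NormedAddCommGroup H] [InnerProductSpace ℂ H]
    (K : Type*) [NormedAddCommGroup K] [InnerProductSpace ℂ K] : Type _ :=
  UniformSpace.Completion (H ⊗[ℂ] K)

/-- The tensor product of two bounded operators, acting on the Hilbert space tensor product
by `x ⊗ y ↦ f x ⊗ g y`. -/
def opTensor (f : H →L[ℂ] H) (g : K →L[ℂ] K) : HilbertTensor H K →L[ℂ] HilbertTensor H K :=
  (TensorProduct.mapL f g).completion

/-- The spatial tensor product of two von Neumann algebras: the von Neumann algebra on the
Hilbert space tensor product generated by the operators `a ⊗ b`. -/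
def spatialTensor (A : VonNeumannAlgebra H) (B : VonNeumannAlgebra K) :
    VonNeumannAlgebra (HilbertTensor H K) :=
  generated {x | ∃ a ∈ A, ∃ b ∈ B, x = opTensor a b}

/-- The elementary tensor `a ⊗ b` as an element of the spatial tensor product. -/
def tmul {A : VonNeumannAlgebra H} {B : VonNeumannAlgebra K} (a : A.Elem) (b : B.Elem) :
    (spatialTensor A B).Elem :=
  ⟨opTensor a.1 b.1, subset_generated _ ⟨a.1, a.2, b.1, b.2, rfl⟩⟩

/-- A linear map is positive if it sends positive elements to positive elements. -/
def IsPositiveMap {A : VonNeumannAlgebra H} {B : VonNeumannAlgebra K}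
    (φ : A.Elem →ₗ[ℂ] B.Elem) : Prop :=
  ∀ a : A.Elem, 0 ≤ a → 0 ≤ φ a

/-- Normality of a (positive) linear map: it preserves suprema of bounded directed sets of
self-adjoint elements. -/
def IsNormalMap {A : VonNeumannAlgebra H} {B : VonNeumannAlgebra K}
    (φ : A.Elem →ₗ[ℂ] B.Elem) : Prop :=
  ∀ (D : Set A.Elem) (s : A.Elem), (∀ a ∈ D, IsSelfAdjoint a) → D.Nonempty →
    DirectedOn (· ≤ ·) D → IsLUB D s → IsLUB (φ '' D) (φ s)

/-- A duplicator with unit `u` on `A`: a normal positive subunital linear map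
`δ : A ⊗ A → A`, where `0 ≤ u ≤ 1` and `δ (a ⊗ u) = a = δ (u ⊗ a)` for all `a`. -/
structure IsDuplicatorWithUnit (A : VonNeumannAlgebra H)
    (δ : (spatialTensor A A).Elem →ₗ[ℂ] A.Elem) (u : A.Elem) : Prop where
  normal : IsNormalMap δ
  positive : IsPositiveMap δ
  subunital : δ 1 ≤ 1
  unit_nonneg : 0 ≤ u
  unit_le_one : u ≤ 1
  map_tmul_unit : ∀ a : A.Elem, δ (tmul a u) = a
  map_unit_tmul : ∀ a : A.Elem, δ (tmul u a) = a

/-- A duplicator on `A`. -/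
def IsDuplicator (A : VonNeumannAlgebra H)
    (δ : (spatialTensor A A).Elem →ₗ[ℂ] A.Elem) : Prop :=
  ∃ u : A.Elem, IsDuplicatorWithUnit A δ u

end VonNeumannAlgebra

end

/-!
The unit of a duplicator is forced to be `1`: the unit law gives
`1 - u = δ (u ⊗ (1 - u)) ≤ δ (1 ⊗ (1 - u)) = δ 1 - 1 ≤ 0`. Hence, for `0 ≤ b ≤ 1`, the map
`f a = δ (a ⊗ b)` is positive and dominated by the identity, because `a - f a = δ (a ⊗ (1 - b))`.

The heart of the proof is that every linear map `f` with `0 ≤ f a ≤ a` for all `a ≥ 0` is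
multiplication by `f 1` (`map_eq_map_one_mul`). If `a` were a finite combination `∑ k, λ k • p k`
of orthogonal projections, one could argue projection by projection. Instead of a spectral
resolution, the Bernstein polynomials `ψ k` evaluated at `a` serve as an approximate one: they are
positive, sum to `1`, have mean `a`, and their variance `∑ k, (a - k / n) ^ 2 * ψ k` is
`a * (1 - a) / n`, which tends to `0`. Testing positivity of the `f (ψ k)` against
`a - k / n - v` with `v = f 1 * a - f a` yields `star v * v ≤ a * (1 - a) / n` for every `n`.

Thus `δ (a ⊗ b) = b * a` for `0 ≤ a, b ≤ 1`, and by the symmetric argument `δ (a ⊗ b) = a * b`.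
Such elements span the algebra, which gives both claims.
-/

open scoped TensorProduct

/-! ### Positive maps dominated by the identity -/

section Dominated

variable {B : Type*} [CStarAlgebra B] [PartialOrder B] [StarOrderedRing B]

theorem aeval_bernsteinPolynomial_nonneg {a : B} (h0 : 0 ≤ a) (h1 : a ≤ 1) (n k : ℕ) :
    0 ≤ Polynomial.aeval a (bernsteinPolynomial ℂ n k) := by
  have hc : Commute (a ^ k) ((1 - a) ^ (n - k)) :=
    ((Commute.one_right a).sub_right (Commute.refl a)).pow_pow _ _
  have h : 0 ≤ a ^ k * (1 - a) ^ (n - k) :=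
    hc.mul_nonneg (CStarAlgebra.pow_nonneg h0 _) (CStarAlgebra.pow_nonneg (sub_nonneg.2 h1) _)
  have : Polynomial.aeval a (bernsteinPolynomial ℂ n k)
      = (n.choose k) • (a ^ k * (1 - a) ^ (n - k)) := by
    simp [bernsteinPolynomial, nsmul_eq_mul, mul_assoc]
  rw [this]
  exact nsmul_nonneg h _

/-- A linear map that is positive and dominated by the identity is left multiplication by its
value at `1`, at least on elements between `0` and `1`. -/
theorem map_eq_map_one_mul {S : StarSubalgebra ℂ B} (f : S →ₗ[ℂ] B)
    (hf0 : ∀ a : S, 0 ≤ a → 0 ≤ f a) (hf : ∀ a : S, 0 ≤ a → f a ≤ a)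
    {a : S} (h0 : 0 ≤ a) (h1 : a ≤ 1) : f a = f 1 * a := by
  have h0' : (0 : B) ≤ a := h0
  have h1' : (a : B) ≤ 1 := h1
  have hsa : star (a : B) = a := (IsSelfAdjoint.of_nonneg h0').star_eq
  set v : B := f 1 * a - f a with hv
  have key : ∀ n : ℕ, (n : ℝ) * (‖v‖ * ‖v‖) ≤ ‖(a : B) * (1 - a)‖ := by
    intro n
    rcases Nat.eq_zero_or_pos n with rfl | hn
    · simp
    let ψ : ℕ → S := fun k => Polynomial.aeval a (bernsteinPolynomial ℂ n k)
    have hψ : ∀ k, (ψ k : B) = Polynomial.aeval (a : B) (bernsteinPolynomial ℂ n k) := fun k =>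
      (Polynomial.aeval_algHom_apply S.subtype.toAlgHom a _).symm
    have hψ0 : ∀ k, 0 ≤ ψ k := fun k => by
      change (0 : B) ≤ ψ k
      rw [hψ]
      exact aeval_bernsteinPolynomial_nonneg h0' h1' n k
    -- Deviations from the mean, scaled by `n` to stay clear of division.
    let y : ℕ → B := fun k => n • (a : B) - (k : B)
    have hy : ∀ k, star (y k) = y k := fun k => by
      simp [y, hsa, nsmul_eq_mul, (Nat.cast_commute n (a : B)).eq]
    have hsum : ∑ k ∈ Finset.range (n + 1), f (ψ k) = f 1 := by
      rw [← map_sum]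
      congr 1
      simpa [ψ] using congrArg (Polynomial.aeval a) (bernsteinPolynomial.sum ℂ n)
    have hmean : ∑ k ∈ Finset.range (n + 1), k • f (ψ k) = n • f a := by
      simp only [← map_nsmul]
      rw [← map_sum]
      congr 1
      simpa [ψ] using congrArg (Polynomial.aeval a) (bernsteinPolynomial.sum_smul ℂ n)
    have hvar : ∑ k ∈ Finset.range (n + 1), y k * ψ k * y k = n • ((a : B) * (1 - a)) := by
      have := congrArg (Polynomial.aeval (a : B)) (bernsteinPolynomial.variance ℂ n)
      simp only [map_sum, map_mul, map_pow, map_sub, map_nsmul, Polynomial.aeval_X, map_natCast,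
        map_one, smul_mul_assoc] at this
      rw [← this]
      refine Finset.sum_congr rfl fun k _ => ?_
      have hc : Commute (Polynomial.aeval (a : B) (bernsteinPolynomial ℂ n k)) (y k) := by
        have : y k = Polynomial.aeval (a : B) (n • Polynomial.X - (k : Polynomial ℂ)) := by
          simp [y]
        rw [this]
        exact (Commute.all _ _).map (Polynomial.aeval (a : B))
      rw [hψ, mul_assoc, hc.eq, ← mul_assoc, sq]
    have hfy : ∑ k ∈ Finset.range (n + 1), f (ψ k) * y k = n • v := by
      have : ∀ k, f (ψ k) * y k = f (ψ k) * (n • (a : B)) - k • f (ψ k) := fun k => by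
        simp [y, mul_sub, nsmul_eq_mul, (Nat.cast_commute k (f (ψ k))).eq]
      simp only [this, Finset.sum_sub_distrib, hmean, ← Finset.sum_mul, hsum]
      rw [hv, smul_sub, mul_smul_comm]
    have hyf : ∑ k ∈ Finset.range (n + 1), y k * f (ψ k) = n • star v := by
      have := congrArg star hfy
      simp only [star_sum, star_mul, hy, star_nsmul] at this
      rw [← this]
      exact Finset.sum_congr rfl fun k _ =>
        by rw [(IsSelfAdjoint.of_nonneg (hf0 _ (hψ0 k))).star_eq]
    -- The mixed terms of this sum contribute `-2 * n ^ 2 * star v * v`, while its last term is at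
    -- most `n ^ 2 * star v * v` because `f 1 ≤ 1`; this leaves a bound on `star v * v`.
    have hpos : 0 ≤ ∑ k ∈ Finset.range (n + 1), star (y k - n • v) * f (ψ k) * (y k - n • v) :=
      Finset.sum_nonneg fun k _ => star_left_conjugate_nonneg (hf0 _ (hψ0 k)) _
    have hexp : ∑ k ∈ Finset.range (n + 1), star (y k - n • v) * f (ψ k) * (y k - n • v)
        = ∑ k ∈ Finset.range (n + 1), y k * f (ψ k) * y k
          - n ^ 2 • (star v * v) - n ^ 2 • (star v * v) + n ^ 2 • (star v * f 1 * v) := by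
      have : ∀ k, star (y k - n • v) * f (ψ k) * (y k - n • v)
          = y k * f (ψ k) * y k - star (n • v) * (f (ψ k) * y k)
            - (y k * f (ψ k)) * (n • v) + star (n • v) * f (ψ k) * (n • v) := fun k => by
        rw [star_sub, hy]
        generalize n • v = w
        noncomm_ring
      simp only [this, Finset.sum_add_distrib, Finset.sum_sub_distrib, ← Finset.mul_sum,
        ← Finset.sum_mul, hsum, hfy, hyf, star_nsmul]
      simp only [smul_mul_assoc, mul_smul_comm, smul_smul, ← sq]
    have hdom : ∑ k ∈ Finset.range (n + 1), y k * f (ψ k) * y k ≤ n • ((a : B) * (1 - a)) := by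
      rw [← hvar]
      refine Finset.sum_le_sum fun k _ => ?_
      simpa only [hy] using star_left_conjugate_le_conjugate (hf _ (hψ0 k)) (y k)
    have hone : n ^ 2 • (star v * f 1 * v) ≤ n ^ 2 • (star v * v) := by
      refine nsmul_le_nsmul_right ?_ _
      have : f 1 ≤ 1 := hf 1 (show (0 : B) ≤ 1 from zero_le_one)
      simpa using star_left_conjugate_le_conjugate this v
    have hle : n ^ 2 • (star v * v) ≤ n • ((a : B) * (1 - a)) := by
      rw [hexp] at hpos
      have h2 := add_le_add hdom hone
      have h3 := add_le_add hpos h2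
      rw [← sub_nonneg] at h3 ⊢
      convert h3 using 1
      abel
    have hnorm := CStarAlgebra.norm_le_norm_of_nonneg_of_le
      (nsmul_nonneg (star_mul_self_nonneg v) _) hle
    rw [← Nat.cast_smul_eq_nsmul ℝ, ← Nat.cast_smul_eq_nsmul ℝ, norm_smul, norm_smul,
      CStarRing.norm_star_mul_self, Real.norm_natCast, Real.norm_natCast] at hnorm
    have hn' : (0 : ℝ) < n := by exact_mod_cast hn
    push_cast at hnorm
    rw [sq, mul_assoc] at hnorm
    exact le_of_mul_le_mul_left hnorm hn'
  have hv0 : v = 0 := by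
    by_contra hne
    have hp : 0 < ‖v‖ * ‖v‖ := by positivity
    obtain ⟨n, hn⟩ := exists_nat_gt (‖(a : B) * (1 - a)‖ / (‖v‖ * ‖v‖))
    exact absurd (key n) (not_le.2 ((div_lt_iff₀ hp).1 hn))
  exact (sub_eq_zero.1 hv0).symm

/-- The elements between `0` and `1` span a star subalgebra: a self-adjoint `s` of norm at most
`t` is a combination of `1` and `(2 * t)⁻¹ • (s + t)`. -/
theorem span_nonneg_le_one (S : StarSubalgebra ℂ B) :
    Submodule.span ℂ {a : S | 0 ≤ a ∧ a ≤ 1} = ⊤ := by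
  have hsa : ∀ s : S, IsSelfAdjoint s → s ∈ Submodule.span ℂ {a : S | 0 ≤ a ∧ a ≤ 1} := by
    intro s hs
    have hs' : IsSelfAdjoint (s : B) := congrArg Subtype.val hs
    -- `t` exceeds the norm by `1` so that it is nonzero.
    set t : ℝ := ‖(s : B)‖ + 1 with ht
    have htpos : 0 < t := by positivity
    have hone : (0 : B) ≤ 1 := zero_le_one
    have hnt : (algebraMap ℝ B ‖(s : B)‖) ≤ t • (1 : B) := by
      rw [Algebra.algebraMap_eq_smul_one, ← sub_nonneg, ← sub_smul]
      exact smul_nonneg (by simp [ht]) hone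
    have hup : (s : B) ≤ t • 1 := hs'.le_algebraMap_norm_self.trans hnt
    have hlow : -(t • 1) ≤ (s : B) :=
      (neg_le_neg hnt).trans hs'.neg_algebraMap_norm_le_self
    let e : S := ((2 * t)⁻¹ : ℝ) • (s + t • 1)
    have he : e ∈ {a : S | 0 ≤ a ∧ a ≤ 1} := by
      constructor
      · change (0 : B) ≤ ((2 * t)⁻¹ : ℝ) • ((s : B) + t • 1)
        refine smul_nonneg (by positivity) ?_
        simpa using add_le_add_left hlow (t • 1)
      · change ((2 * t)⁻¹ : ℝ) • ((s : B) + t • 1) ≤ 1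
        refine (smul_le_smul_of_nonneg_left (add_le_add_left hup (t • 1))
          (by positivity)).trans_eq ?_
        rw [← add_smul, smul_smul, ← two_mul, inv_mul_cancel₀ (by positivity), one_smul]
    have h1 : (1 : S) ∈ {a : S | 0 ≤ a ∧ a ≤ 1} := ⟨hone, le_rfl⟩
    have : s = ((2 * t : ℝ) : ℂ) • e - (t : ℂ) • (1 : S) := by
      simp only [e, Complex.coe_smul]
      rw [smul_smul, mul_inv_cancel₀ (by positivity), one_smul, add_sub_cancel_right]
    rw [this]
    exact sub_mem (Submodule.smul_mem _ _ (Submodule.subset_span he))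
      (Submodule.smul_mem _ _ (Submodule.subset_span h1))
  rw [eq_top_iff]
  intro x _
  rw [← realPart_add_I_smul_imaginaryPart x]
  exact add_mem (hsa _ (realPart x).2) (Submodule.smul_mem _ _ (hsa _ (imaginaryPart x).2))

end Dominated

/-! ### Elementary tensors -/

namespace VonNeumannAlgebra

section opTensor

variable {H : Type*} [NormedAddCommGroup H] [InnerProductSpace ℂ H]
variable {K : Type*} [NormedAddCommGroup K] [InnerProductSpace ℂ K]

theorem opTensor_coe (f : H →L[ℂ] H) (g : K →L[ℂ] K) (x : H ⊗[ℂ] K) :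
    opTensor f g (x : HilbertTensor H K) = (TensorProduct.mapL f g x : HilbertTensor H K) :=
  ContinuousLinearMap.completion_apply_coe _ _

theorem opTensor_ext {S T : HilbertTensor H K →L[ℂ] HilbertTensor H K}
    (h : ∀ x : H ⊗[ℂ] K, S (x : HilbertTensor H K) = T (x : HilbertTensor H K)) : S = T := by
  ext x
  exact UniformSpace.Completion.induction_on x (isClosed_eq S.continuous T.continuous) h

theorem opTensor_add_left (f₁ f₂ : H →L[ℂ] H) (g : K →L[ℂ] K) :
    opTensor (f₁ + f₂) g = opTensor f₁ g + opTensor f₂ g :=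
  opTensor_ext fun x => by
    simp only [opTensor_coe, add_apply, TensorProduct.mapL_add_left,
      UniformSpace.Completion.coe_add]

theorem opTensor_add_right (f : H →L[ℂ] H) (g₁ g₂ : K →L[ℂ] K) :
    opTensor f (g₁ + g₂) = opTensor f g₁ + opTensor f g₂ :=
  opTensor_ext fun x => by
    simp only [opTensor_coe, add_apply, TensorProduct.mapL_add_right,
      UniformSpace.Completion.coe_add]

theorem opTensor_smul_left (c : ℂ) (f : H →L[ℂ] H) (g : K →L[ℂ] K) :
    opTensor (c • f) g = c • opTensor f g :=
  opTensor_ext fun x => by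
    simp only [opTensor_coe, smul_apply, TensorProduct.mapL_smul_left,
      UniformSpace.Completion.coe_smul]

theorem opTensor_smul_right (c : ℂ) (f : H →L[ℂ] H) (g : K →L[ℂ] K) :
    opTensor f (c • g) = c • opTensor f g :=
  opTensor_ext fun x => by
    simp only [opTensor_coe, smul_apply, TensorProduct.mapL_smul_right,
      UniformSpace.Completion.coe_smul]

theorem opTensor_one : opTensor (1 : H →L[ℂ] H) (1 : K →L[ℂ] K) = 1 :=
  opTensor_ext fun x => by
    rw [opTensor_coe]
    exact congrArg _ (DFunLike.congr_fun TensorProduct.mapL_id_id x)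

theorem opTensor_mul (f₁ f₂ : H →L[ℂ] H) (g₁ g₂ : K →L[ℂ] K) :
    opTensor (f₁ * f₂) (g₁ * g₂) = opTensor f₁ g₁ * opTensor f₂ g₂ :=
  opTensor_ext fun x => by
    simp only [opTensor_coe, mul_apply_eq_comp, TensorProduct.mapL_mul]

variable [CompleteSpace H] [CompleteSpace K]

theorem star_opTensor (f : H →L[ℂ] H) (g : K →L[ℂ] K) :
    star (opTensor f g) = opTensor (star f) (star g) := by
  -- The algebraic tensor product is incomplete, so `TensorProduct.adjoint_mapL` does not apply.
  have hmap : ∀ x y : H ⊗[ℂ] K,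
      inner ℂ (TensorProduct.mapL f g x) y =
        inner ℂ x (TensorProduct.mapL (star f) (star g) y) := by
    intro x y
    induction x with
    | zero => simp
    | add x₁ x₂ h₁ h₂ => rw [map_add, inner_add_left, inner_add_left, h₁, h₂]
    | tmul a b =>
      induction y with
      | zero => simp
      | add y₁ y₂ h₁ h₂ => rw [map_add, inner_add_right, inner_add_right, h₁, h₂]
      | tmul c d =>
        rw [TensorProduct.mapL_tmul, TensorProduct.mapL_tmul, TensorProduct.inner_tmul,
          TensorProduct.inner_tmul, ContinuousLinearMap.star_eq_adjoint,
          ContinuousLinearMap.star_eq_adjoint, ContinuousLinearMap.adjoint_inner_right,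
          ContinuousLinearMap.adjoint_inner_right]
  rw [ContinuousLinearMap.star_eq_adjoint, eq_comm, ContinuousLinearMap.eq_adjoint_iff]
  intro x y
  refine UniformSpace.Completion.induction_on₂ x y
    (isClosed_eq (by fun_prop) (by fun_prop)) fun x y => ?_
  rw [opTensor_coe, opTensor_coe, UniformSpace.Completion.inner_coe,
    UniformSpace.Completion.inner_coe, ← inner_conj_symm, ← hmap, inner_conj_symm]

theorem opTensor_nonneg {f : H →L[ℂ] H} {g : K →L[ℂ] K} (hf : 0 ≤ f) (hg : 0 ≤ g) :
    0 ≤ opTensor f g := by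
  obtain ⟨c, rfl⟩ := CStarAlgebra.nonneg_iff_eq_star_mul_self.1 hf
  obtain ⟨d, rfl⟩ := CStarAlgebra.nonneg_iff_eq_star_mul_self.1 hg
  rw [opTensor_mul, ← star_opTensor]
  exact star_mul_self_nonneg (opTensor c d)

end opTensor

variable {H : Type*} [NormedAddCommGroup H] [InnerProductSpace ℂ H] [CompleteSpace H]
variable {K : Type*} [NormedAddCommGroup K] [InnerProductSpace ℂ K] [CompleteSpace K]
variable {A : VonNeumannAlgebra H} {B : VonNeumannAlgebra K}

/-- The elementary tensor `a ⊗ b` as a bilinear map into the spatial tensor product. -/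
noncomputable def tmulₗ (A : VonNeumannAlgebra H) (B : VonNeumannAlgebra K) :
    A.Elem →ₗ[ℂ] B.Elem →ₗ[ℂ] (spatialTensor A B).Elem :=
  LinearMap.mk₂ ℂ tmul
    (fun _ _ _ => Subtype.ext (opTensor_add_left _ _ _))
    (fun _ _ _ => Subtype.ext (opTensor_smul_left _ _ _))
    (fun _ _ _ => Subtype.ext (opTensor_add_right _ _ _))
    (fun _ _ _ => Subtype.ext (opTensor_smul_right _ _ _))

@[simp]
theorem tmulₗ_apply (a : A.Elem) (b : B.Elem) : tmulₗ A B a b = tmul a b := rfl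

theorem tmul_nonneg {a : A.Elem} {b : B.Elem} (ha : 0 ≤ a) (hb : 0 ≤ b) : 0 ≤ tmul a b :=
  opTensor_nonneg (f := a.1) (g := b.1) ha hb

theorem tmul_one_one : tmul (1 : A.Elem) (1 : B.Elem) = 1 :=
  Subtype.ext opTensor_one

/-! ### Duplicators -/

namespace IsDuplicatorWithUnit

variable {δ : (spatialTensor A A).Elem →ₗ[ℂ] A.Elem} {u : A.Elem}

/-- The sum of `1 - δ 1 ≥ 0` and `δ ((1 - u) ⊗ (1 - u)) = δ 1 - 1 - (1 - u) ≥ 0` is `u - 1`. -/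
theorem unit_eq_one (h : IsDuplicatorWithUnit A δ u) : u = 1 := by
  refine le_antisymm h.unit_le_one (sub_nonneg.1 ?_)
  have h1 : 0 ≤ 1 - u := sub_nonneg.2 h.unit_le_one
  have h2 : 0 ≤ δ (tmul (1 - u) (1 - u)) := h.positive _ (tmul_nonneg h1 h1)
  have h3 : δ (tmul (1 - u) (1 - u)) = δ 1 - 1 - (1 - u) := by
    simp only [← tmulₗ_apply, map_sub, LinearMap.sub_apply]
    simp only [tmulₗ_apply, h.map_tmul_unit, h.map_unit_tmul, tmul_one_one]
  have h4 : 0 ≤ 1 - δ 1 := sub_nonneg.2 h.subunital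
  have h6 : u - 1 = (1 - δ 1) + δ (tmul (1 - u) (1 - u)) := by
    rw [h3]
    abel
  rw [h6]
  exact add_nonneg h4 h2

/-- `a ↦ δ (a ⊗ b)` is positive and dominated by the identity, since `a - δ (a ⊗ b)` equals
`δ (a ⊗ (1 - b))`; its value at `1` is `b`. -/
theorem map_tmul_eq_mul_swap (h : IsDuplicatorWithUnit A δ u) {a b : A.Elem}
    (ha0 : 0 ≤ a) (ha1 : a ≤ 1) (hb0 : 0 ≤ b) (hb1 : b ≤ 1) : δ (tmul a b) = b * a := by
  obtain rfl := h.unit_eq_one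
  let f : A.Elem →ₗ[ℂ] (H →L[ℂ] H) :=
    A.toStarSubalgebra.subtype.toAlgHom.toLinearMap ∘ₗ δ ∘ₗ (tmulₗ A A).flip b
  have hf0 : ∀ a : A.Elem, 0 ≤ a → 0 ≤ f a := fun a ha => h.positive _ (tmul_nonneg ha hb0)
  have hf : ∀ a : A.Elem, 0 ≤ a → f a ≤ a := fun a ha => by
    refine sub_nonneg (α := A.Elem) |>.1 (?_ : 0 ≤ a - δ (tmul a b))
    have h1 : a - δ (tmul a b) = δ (tmul a (1 - b)) := by
      rw [← tmulₗ_apply a (1 - b), map_sub, map_sub, tmulₗ_apply, tmulₗ_apply, h.map_tmul_unit]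
    rw [h1]
    exact h.positive _ (tmul_nonneg ha (sub_nonneg.2 hb1))
  have h1 : f 1 = b := congrArg Subtype.val (h.map_unit_tmul b)
  have h2 := map_eq_map_one_mul f hf0 hf ha0 ha1
  rw [h1] at h2
  exact Subtype.ext h2

/-- The counterpart of `map_tmul_eq_mul_swap` in the second variable: the map `b ↦ δ (a ⊗ b)` has
value `a` at `1`. -/
theorem map_tmul_eq_mul (h : IsDuplicatorWithUnit A δ u) {a b : A.Elem}
    (ha0 : 0 ≤ a) (ha1 : a ≤ 1) (hb0 : 0 ≤ b) (hb1 : b ≤ 1) : δ (tmul a b) = a * b := by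
  obtain rfl := h.unit_eq_one
  let f : A.Elem →ₗ[ℂ] (H →L[ℂ] H) :=
    A.toStarSubalgebra.subtype.toAlgHom.toLinearMap ∘ₗ δ ∘ₗ tmulₗ A A a
  have hf0 : ∀ b : A.Elem, 0 ≤ b → 0 ≤ f b := fun b hb => h.positive _ (tmul_nonneg ha0 hb)
  have hf : ∀ b : A.Elem, 0 ≤ b → f b ≤ b := fun b hb => by
    refine sub_nonneg (α := A.Elem) |>.1 (?_ : 0 ≤ b - δ (tmul a b))
    have h1 : b - δ (tmul a b) = δ (tmul (1 - a) b) := by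
      rw [← tmulₗ_apply (1 - a) b, map_sub, LinearMap.sub_apply, map_sub, tmulₗ_apply,
        tmulₗ_apply, h.map_unit_tmul]
    rw [h1]
    exact h.positive _ (tmul_nonneg (sub_nonneg.2 ha1) hb)
  have h1 : f 1 = a := congrArg Subtype.val (h.map_tmul_unit a)
  have h2 := map_eq_map_one_mul f hf0 hf hb0 hb1
  rw [h1] at h2
  exact Subtype.ext h2

end IsDuplicatorWithUnit

/-- Bilinear maps on a von Neumann algebra are determined by their values on elements between
`0` and `1`. -/
theorem bilinear_ext {M : Type*} [AddCommMonoid M] [Module ℂ M]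
    {S T : A.Elem →ₗ[ℂ] A.Elem →ₗ[ℂ] M}
    (h : ∀ a b : A.Elem, 0 ≤ a → a ≤ 1 → 0 ≤ b → b ≤ 1 → S a b = T a b) : S = T :=
  LinearMap.ext_on (span_nonneg_le_one A.toStarSubalgebra) fun a ha =>
    LinearMap.ext_on (span_nonneg_le_one A.toStarSubalgebra) fun b hb =>
      h a b ha.1 ha.2 hb.1 hb.2

end VonNeumannAlgebra

theorem mainTheorem8 {H : Type*} [NormedAddCommGroup H] [InnerProductSpace ℂ H]
    [CompleteSpace H] (A : VonNeumannAlgebra H)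
    (δ : (A.spatialTensor A).Elem →ₗ[ℂ] A.Elem) (hδ : A.IsDuplicator δ) :
    (∀ a b : A.Elem, a * b = b * a) ∧
      ∀ a b : A.Elem, δ (VonNeumannAlgebra.tmul a b) = a * b := by
  obtain ⟨u, h⟩ := hδ
  have hmul : (VonNeumannAlgebra.tmulₗ A A).compr₂ δ = LinearMap.mul ℂ A.Elem :=
    VonNeumannAlgebra.bilinear_ext fun _ _ ha0 ha1 hb0 hb1 =>
      h.map_tmul_eq_mul ha0 ha1 hb0 hb1
  have hswap : (VonNeumannAlgebra.tmulₗ A A).compr₂ δ = (LinearMap.mul ℂ A.Elem).flip :=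
    VonNeumannAlgebra.bilinear_ext fun _ _ ha0 ha1 hb0 hb1 =>
      h.map_tmul_eq_mul_swap ha0 ha1 hb0 hb1
  exact ⟨fun a b => LinearMap.congr_fun₂ (hmul.symm.trans hswap) a b,
    fun a b => LinearMap.congr_fun₂ hmul a b⟩
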